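/- Let $Q$ be an irreducible transition kernel on a finite nonempty set $E$ that is reversible with respect to its stationary probability distribution $\pi$, and for $t\ge 0$ let $Q_t=\sum_{\ell\ge 0}e^{-t}\frac{t^\ell}{\ell!}Q^\ell=e^{t(Q-\mathrm{Id})}$. Let $X=(X_t)_{t\ge 0}$ and $Y=(Y_t)_{t\ge 0}$ be two independent rate-$1$ continuous-time Markov chains on $E$ with kernel $Q$, that is, Markov processes with almost surely right-continuous paths and transition matrices $(Q_t)_{t\ge0}$, both started from the distribution $\pi$. Let $M=\inf\{t\ge 0: X_t=Y_t\}$ be their meeting time, and write $\mathbb E[e^{-\lambda M};X_M=x]=\mathbb E[e^{-\lambda M}\mathbf 1_{\{M<\infty,\,X_M=x\}}]$. Then for every $\lambda\in(0,\infty)$, $$\mathbb E\big[e^{-\lambda M};X_M=x\big]\le \frac{2+\lambda}{\lambda}\,\pi(x)^2\qquad\text{for all }x\in E.$$ Moreover, the matrix $R_\lambda$ given by $$R_\lambda(x,y)=2\,\frac{\pi(y)}{\pi(x)}\int_0^\infty e^{-\lambda t}\,Q_t(y,x)\,(QQ_t)(y,x)\,dt,\qquad x,y\in E,$$ is well defined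 (the integrals converge), symmetric, and has nonnegative entries, and the function $F_\lambda(x)=\pi(x)^{-1}\,\mathbb E[e^{-\lambda M};X_M=x]$, $x\in E$, solves the linear equation $$(\mathrm{Id}+R_\lambda)F_\lambda=\frac{2+\lambda}{\lambda}\,\pi .$$ -/

import Mathlib

open MeasureTheory ProbabilityTheory Matrix
open scoped NNReal ENNReal Topology

noncomputable section

namespace MeetingTimes

/-- `Q` is an irreducible transition kernel (row-stochastic matrix) on the finite set `E`, and `π`
is a stationary probability distribution of `Q` with respect to which `Q` is reversible. -/
structure IsReversibleKernel {E : Type*} [Fintype E] [DecidableEq E]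
    (Q : Matrix E E ℝ) (π : E → ℝ) : Prop where
  stochastic : Q ∈ rowStochastic ℝ E
  irreducible : Q.IsIrreducible
  prob : π ∈ stdSimplex ℝ E
  stationary : π ᵥ* Q = π
  reversible : ∀ x y, π x * Q x y = π y * Q y x

/-- The transition matrices `Q_t = exp (t (Q - 1))` of the rate-`1` chain with kernel `Q`
(here `NormedSpace.exp` is the matrix exponential). -/
def semigroup {E : Type*} [Fintype E] [DecidableEq E] (Q : Matrix E E ℝ) (t : ℝ) : Matrix E E ℝ :=
  NormedSpace.exp (t • (Q - 1))

/-- `X` is a rate-`1` `(E, Q)`-Markov chain on the probability space `(Ω, P)` with initial law `ν`: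
it has the finite-dimensional distributions
`P (X_0 = x_0, X_{t_1} = x_1, …, X_{t_n} = x_n) = ν(x_0) ∏ Q_{t_{i+1} - t_i}(x_i, x_{i+1})`
for `0 = t_0 ≤ t_1 ≤ … ≤ t_n`, and almost all its paths are right-continuous for the discrete
topology of `E`. -/
structure IsRateOneChain {E : Type*} [Fintype E] [DecidableEq E] [MeasurableSpace E]
    (Q : Matrix E E ℝ) (ν : E → ℝ) {Ω : Type*} [MeasurableSpace Ω] (P : Measure Ω)
    (X : ℝ≥0 → Ω → E) : Prop where
  measurable : ∀ t, Measurable (X t)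
  law : ∀ (n : ℕ) (t : Fin (n + 1) → ℝ≥0) (x : Fin (n + 1) → E), t 0 = 0 → Monotone t →
    P.real {ω | ∀ i, X (t i) ω = x i} =
      ν (x 0) * ∏ i : Fin n,
        semigroup Q ((t i.succ : ℝ) - (t i.castSucc : ℝ)) (x i.castSucc) (x i.succ)
  rightContinuous : ∀ᵐ ω ∂P, ∀ t, ∀ᶠ s in 𝓝[>] t, X s ω = X t ω

/-- The meeting time `M = inf {t ≥ 0 ; X_t = Y_t}`, with value `∞` if the paths never meet. -/
def meetingTime {E Ω : Type*} (X Y : ℝ≥0 → Ω → E) (ω : Ω) : ℝ≥0∞ :=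
  sInf ((fun t : ℝ≥0 => (t : ℝ≥0∞)) '' {t : ℝ≥0 | X t ω = Y t ω})

open Classical in
/-- The random variable `e^{-λ M} 1_{X_M = x}`, which is `0` where `M = ∞`. -/
def meetingWeight {E Ω : Type*} (X Y : ℝ≥0 → Ω → E) (lam : ℝ) (x : E) (ω : Ω) : ℝ :=
  if meetingTime X Y ω < ∞ ∧ X (meetingTime X Y ω).toNNReal ω = x then
    Real.exp (-lam * (meetingTime X Y ω).toReal)
  else 0

/-- `E[e^{-λ M}; X_M = x]`. -/
def meetingLaplace {E Ω : Type*} [MeasurableSpace Ω] (P : Measure Ω) (X Y : ℝ≥0 → Ω → E)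
    (lam : ℝ) (x : E) : ℝ :=
  ∫ ω, meetingWeight X Y lam x ω ∂P

/-- `F_λ(x) = π(x)⁻¹ E[e^{-λ M}; X_M = x]`. -/
def F {E Ω : Type*} [MeasurableSpace Ω] (π : E → ℝ) (P : Measure Ω) (X Y : ℝ≥0 → Ω → E)
    (lam : ℝ) (x : E) : ℝ :=
  (π x)⁻¹ * meetingLaplace P X Y lam x

/-- The function `t ↦ e^{-λ t} Q_t(y, x) (Q Q_t)(y, x)` whose integral enters `R_λ(x, y)`. -/
def RIntegrand {E : Type*} [Fintype E] [DecidableEq E] (Q : Matrix E E ℝ) (lam : ℝ) (x y : E)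
    (t : ℝ) : ℝ :=
  Real.exp (-lam * t) * semigroup Q t y x * (Q * semigroup Q t) y x

/-- `R_λ(x, y) = 2 (π(y) / π(x)) ∫_0^∞ e^{-λ t} Q_t(y, x) (Q Q_t)(y, x) dt`. -/
def R {E : Type*} [Fintype E] [DecidableEq E] (Q : Matrix E E ℝ) (π : E → ℝ) (lam : ℝ) :
    Matrix E E ℝ :=
  Matrix.of fun x y => 2 * (π y / π x) * ∫ t in Set.Ioi (0 : ℝ), RIntegrand Q lam x y t

end MeetingTimes

end

/-! Let `G(y,x) = ∫ e^{-λt} Q_t(y,x)² dt` (`diagResolvent`). If the chains are both at `x` at time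
`t`, they have met by then, and after meeting at `y` the pair moves independently from `(y,y)`. As
`P(X_t = Y_t = x) = π(x)²`, Laplace transformation in `t` gives `∑_y E[e^{-λM}; X_M = y] G(y,x) =
π(x)²/λ`, which is `sum_meetingLaplace_mul_diagResolvent`.

Integrating by parts (`one_add_two_mul_integral_RIntegrand`) turns `(2+λ) G(y,x)` into `δ_{xy}` plus
twice the integral in `R_λ(x,y)`. Multiplying the renewal identity by `(2+λ)/π(x)` is then the
linear equation. The inequality follows because `R_λ F_λ ≥ 0` may be dropped.

No strong Markov property in continuous time is needed. On a grid of mesh `h` the first meeting is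
decided by finitely many coordinates, so the decomposition (`sum_measureReal_gridMeeting_mul`) comes
from the finite-dimensional laws and independence. Generating functions make it a product identity
(`sum_integral_gridWeight_mul`). As `h → 0`, right-continuity makes the grid meeting converge to the
true one (`tendsto_gridWeight`), and the sums over time become `G` (`tendsto_riemannSum`). -/

namespace MeetingTimes

/-! ### The semigroup `Q_t`: stochasticity and reversibility. -/

section Semigroup

variable {E : Type*} [Fintype E] [DecidableEq E] {Q : Matrix E E ℝ} {π : E → ℝ}

@[simp]
lemma semigroup_zero : semigroup Q 0 = 1 := by
  simp [semigroup, NormedSpace.exp_zero]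

lemma hasDerivAt_exp_smul_apply (A : Matrix E E ℝ) (t : ℝ) (a b : E) :
    HasDerivAt (fun s : ℝ => NormedSpace.exp (s • A) a b) ((A * NormedSpace.exp (t • A)) a b) t := by
  open scoped Matrix.Norms.Operator in
  have h := hasDerivAt_exp_smul_const' (𝕂 := ℝ) A t
  exact hasDerivAt_pi.1 (hasDerivAt_pi.1 h a) b

lemma hasDerivAt_semigroup_apply (Q : Matrix E E ℝ) (t : ℝ) (a b : E) :
    HasDerivAt (fun s : ℝ => semigroup Q s a b)
      ((Q * semigroup Q t) a b - semigroup Q t a b) t := by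
  have h := hasDerivAt_exp_smul_apply (Q - 1) t a b
  rwa [Matrix.sub_mul, Matrix.one_mul] at h

lemma continuous_semigroup_apply (Q : Matrix E E ℝ) (a b : E) :
    Continuous fun t : ℝ => semigroup Q t a b :=
  continuous_iff_continuousAt.2 fun t => (hasDerivAt_semigroup_apply Q t a b).continuousAt

lemma exp_apply_nonneg {A : Matrix E E ℝ} (hA : ∀ a b, 0 ≤ A a b) (a b : E) :
    0 ≤ NormedSpace.exp A a b := by
  have hpow : ∀ n : ℕ, ∀ a b, 0 ≤ (A ^ n) a b := by
    intro n
    induction n with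
    | zero => intro a b; rw [pow_zero, Matrix.one_apply]; split_ifs <;> simp
    | succ n ih =>
      intro a b
      rw [pow_succ, Matrix.mul_apply]
      exact Finset.sum_nonneg fun c _ => mul_nonneg (ih a c) (hA c b)
  open scoped Matrix.Norms.Operator in
  have h := NormedSpace.exp_series_hasSum_exp' (𝕂 := ℝ) A
  refine (Pi.hasSum.1 (Pi.hasSum.1 h a) b).nonneg fun n => ?_
  exact mul_nonneg (by positivity) (hpow n a b)

/-- The generator may have negative diagonal entries. Splitting off the scalar leaves, for `t ≥ 0`
and `Q ≥ 0`, the exponential of a nonnegative matrix, whence `Q_t ≥ 0`. -/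
lemma semigroup_eq_smul_exp (Q : Matrix E E ℝ) (t : ℝ) :
    semigroup Q t = Real.exp (-t) • NormedSpace.exp (t • Q) := by
  have h : t • (Q - 1) = (-t) • (1 : Matrix E E ℝ) + t • Q := by
    rw [smul_sub, neg_smul]; abel
  have hd : (-t) • (1 : Matrix E E ℝ) = diagonal fun _ => -t := by
    rw [smul_one_eq_diagonal]
  rw [semigroup, h, Matrix.exp_add_of_commute _ _ ((Commute.one_left _).smul_left _), hd,
    Matrix.exp_diagonal]
  ext a b
  rw [Matrix.diagonal_mul, Matrix.smul_apply, smul_eq_mul, Pi.coe_exp, Real.exp_eq_exp_ℝ]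

lemma semigroup_mulVec_one (hQ : Q ∈ rowStochastic ℝ E) (t : ℝ) :
    semigroup Q t *ᵥ 1 = 1 := by
  have key : ∀ a, ∀ s : ℝ, HasDerivAt (fun s => (semigroup Q s *ᵥ 1) a) 0 s := by
    intro a s
    have hcomm : (Q - 1) * semigroup Q s = semigroup Q s * (Q - 1) := by
      have : Commute (Q - 1) (s • (Q - 1)) := (Commute.refl _).smul_right s
      exact this.exp_right
    have h : HasDerivAt (fun s => ∑ b, semigroup Q s a b)
        (∑ b, ((Q - 1) * semigroup Q s) a b) s :=
      HasDerivAt.fun_sum fun b _ => hasDerivAt_exp_smul_apply (Q - 1) s a b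
    have h0 : ∑ b, ((Q - 1) * semigroup Q s) a b = 0 := by
      have : ((semigroup Q s * (Q - 1)) *ᵥ 1) a = 0 := by
        rw [← Matrix.mulVec_mulVec, Matrix.sub_mulVec, Matrix.one_mulVec,
          one_vecMul_of_mem_rowStochastic hQ, sub_self, Matrix.mulVec_zero]; rfl
      rw [hcomm]
      simpa [Matrix.mulVec, dotProduct] using this
    rw [h0] at h
    simpa [Matrix.mulVec, dotProduct] using h
  ext a
  have := is_const_of_deriv_eq_zero (fun s => (key a s).differentiableAt)
    (fun s => (key a s).deriv) t 0
  simpa using this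

lemma semigroup_mem_rowStochastic (hQ : Q ∈ rowStochastic ℝ E) {t : ℝ} (ht : 0 ≤ t) :
    semigroup Q t ∈ rowStochastic ℝ E := by
  refine mem_rowStochastic.2 ⟨fun a b => ?_, semigroup_mulVec_one hQ t⟩
  rw [semigroup_eq_smul_exp]
  refine mul_nonneg (Real.exp_nonneg _) (exp_apply_nonneg (fun a b => ?_) a b)
  exact mul_nonneg ht (nonneg_of_mem_rowStochastic hQ)

namespace IsReversibleKernel

/-- Some state carries mass, irreducibility moves part of it to `b` in `k` steps, and `π` is
invariant under `Q ^ k`. -/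
lemma pos (hQ : IsReversibleKernel Q π) (b : E) : 0 < π b := by
  have hpow : ∀ n : ℕ, π ᵥ* Q ^ n = π := by
    intro n
    induction n with
    | zero => simp
    | succ n ih => rw [pow_succ, ← Matrix.vecMul_vecMul, ih, hQ.stationary]
  obtain ⟨a, -, ha⟩ : ∃ a ∈ Finset.univ, 0 < π a := by
    refine Finset.exists_lt_of_sum_lt ?_
    simp [hQ.prob.2]
  obtain ⟨k, -, hk⟩ := (isIrreducible_iff_exists_pow_pos hQ.irreducible.nonneg).1 hQ.irreducible a b
  have hQk : Q ^ k ∈ rowStochastic ℝ E := pow_mem hQ.stochastic k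
  rw [← hpow k]
  exact (mul_pos ha hk).trans_le <| Finset.single_le_sum (f := fun i => π i * (Q ^ k) i b)
    (fun i _ => mul_nonneg (hQ.prob.1 i) (nonneg_of_mem_rowStochastic hQk)) (Finset.mem_univ a)

/-- Reversibility means that conjugation by `diagonal π` transposes the generator; the exponential
respects both conjugation and transposition. -/
lemma semigroup_reversible (hQ : IsReversibleKernel Q π) (t : ℝ) (a b : E) :
    π a * semigroup Q t a b = π b * semigroup Q t b a := by
  have hU : IsUnit (diagonal π) := by
    rw [Matrix.isUnit_diagonal, Pi.isUnit_iff]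
    exact fun x => (hQ.pos x).ne'.isUnit
  have hdet := (Matrix.isUnit_iff_isUnit_det _).1 hU
  have hD : diagonal π * (t • (Q - 1)) = (t • (Q - 1))ᵀ * diagonal π := by
    ext x y
    have := hQ.reversible x y
    rcases eq_or_ne x y with rfl | hxy
    · simp [Matrix.diagonal_mul, Matrix.mul_diagonal, mul_comm]
    · simp only [diagonal_mul, Matrix.mul_diagonal, transpose_apply, Matrix.smul_apply, Matrix.sub_apply,
        one_apply_ne hxy, one_apply_ne hxy.symm, sub_zero, smul_eq_mul]
      linear_combination t * this
  have hconj : diagonal π * (t • (Q - 1)) * (diagonal π)⁻¹ = (t • (Q - 1))ᵀ := by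
    rw [hD, Matrix.mul_assoc, Matrix.mul_nonsing_inv _ hdet, Matrix.mul_one]
  have h := Matrix.exp_conj (diagonal π) (t • (Q - 1)) hU
  rw [hconj, Matrix.exp_transpose] at h
  have h2 : (semigroup Q t)ᵀ * diagonal π = diagonal π * semigroup Q t := by
    rw [semigroup, h, Matrix.mul_assoc, Matrix.nonsing_inv_mul _ hdet, Matrix.mul_one]
  have h3 := congrFun (congrFun h2 a) b
  rw [Matrix.mul_diagonal, Matrix.diagonal_mul, transpose_apply] at h3
  linarith

lemma mul_semigroup_reversible (hQ : IsReversibleKernel Q π) (t : ℝ) (a b : E) :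
    π a * (Q * semigroup Q t) a b = π b * (Q * semigroup Q t) b a := by
  have hcomm : Q * semigroup Q t = semigroup Q t * Q := by
    have : Commute Q (t • (Q - 1)) :=
      ((Commute.refl Q).sub_right (Commute.one_right Q)).smul_right t
    exact this.exp_right
  conv_rhs => rw [hcomm]
  rw [Matrix.mul_apply, Matrix.mul_apply, Finset.mul_sum, Finset.mul_sum]
  refine Finset.sum_congr rfl fun c _ => ?_
  rw [← mul_assoc, hQ.reversible a c, ← mul_assoc, ← hQ.semigroup_reversible t c b]
  ring

lemma sum_mul_semigroup (hQ : IsReversibleKernel Q π) (t : ℝ) (b : E) :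
    ∑ a, π a * semigroup Q t a b = π b := by
  simp_rw [fun a => hQ.semigroup_reversible t a b, ← Finset.mul_sum]
  have := congrFun (semigroup_mulVec_one hQ.stochastic t) b
  simp only [mulVec, dotProduct, Pi.one_apply, mul_one] at this
  rw [this, mul_one]

end IsReversibleKernel

end Semigroup

end MeetingTimes

namespace MeetingTimes

/-! ### Riemann sums on the half-line. -/

section RiemannSum

open Filter

/-- The Riemann sums `h ∑ₖ f (k h)` are integrals of step functions. -/
lemma integral_comp_floor {f : ℝ → ℝ} {h : ℝ} (hh : 0 < h)
    (hint : IntegrableOn (fun t : ℝ => f (⌊t / h⌋₊ * h)) (Set.Ioi 0)) :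
    ∫ t in Set.Ioi (0 : ℝ), f (⌊t / h⌋₊ * h) = h * ∑' k : ℕ, f (k * h) := by
  set s : ℕ → Set ℝ := fun k => Set.Ico (k * h) ((k + 1) * h) with hs
  have hmem : ∀ k t, t ∈ s k ↔ 0 ≤ t ∧ ⌊t / h⌋₊ = k := by
    intro k t
    rw [hs, Set.mem_Ico, ← le_div_iff₀ hh, ← div_lt_iff₀ hh]
    constructor
    · rintro ⟨h1, h2⟩
      have h0 : 0 ≤ t / h := k.cast_nonneg.trans h1
      refine ⟨by simpa [hh.le, hh.ne'] using mul_nonneg h0 hh.le, ?_⟩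
      exact (Nat.floor_eq_iff h0).2 ⟨h1, h2⟩
    · rintro ⟨h1, h2⟩
      exact (Nat.floor_eq_iff (div_nonneg h1 hh.le)).1 h2
  have hU : ⋃ k, s k = Set.Ici 0 := by
    ext t
    simp only [Set.mem_iUnion, hmem, Set.mem_Ici]
    exact ⟨fun ⟨_, ht, _⟩ => ht, fun ht => ⟨_, ht, rfl⟩⟩
  have hdisj : Pairwise (Function.onFun Disjoint s) := by
    intro i j hij
    refine Set.disjoint_left.2 fun t hi hj => hij ?_
    rw [← ((hmem i t).1 hi).2, ((hmem j t).1 hj).2]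
  rw [← integral_Ici_eq_integral_Ioi, ← hU,
    integral_iUnion (fun k => measurableSet_Ico) hdisj
      (by rw [hU]; exact (integrableOn_Ici_iff_integrableOn_Ioi (by simp)).2 hint), ← tsum_mul_left]
  refine tsum_congr fun k => ?_
  rw [setIntegral_congr_fun (g := fun _ => f (k * h)) measurableSet_Ico
    (fun t ht => by simp only; rw [((hmem k t).1 ht).2])]
  rw [setIntegral_const, Real.volume_real_Ico_of_le (by nlinarith), smul_eq_mul]
  ring

/-- Dominated convergence for the step functions that sample `f` at the grid point below `t`. -/
lemma tendsto_riemannSum {f : ℝ → ℝ} {lam : ℝ} (hlam : 0 < lam) (hf : Continuous f)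
    (hbound : ∀ t, 0 ≤ t → |f t| ≤ Real.exp (-lam * t)) {h : ℕ → ℝ} (hpos : ∀ n, 0 < h n)
    (hle : ∀ n, h n ≤ 1) (hlim : Tendsto h atTop (𝓝 0)) :
    Tendsto (fun n => h n * ∑' k : ℕ, f (k * h n)) atTop (𝓝 (∫ t in Set.Ioi (0 : ℝ), f t)) := by
  have hmeas : ∀ n, Measurable fun t : ℝ => f (⌊t / h n⌋₊ * h n) := fun n =>
    hf.measurable.comp (((measurable_from_nat (f := fun k : ℕ => (k : ℝ))).comp
      (Nat.measurable_floor.comp (measurable_id.div_const _))).mul_const _)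
  -- Rounding down to the grid lowers `t` by at most `h n ≤ 1`, which costs the factor `e^λ`.
  have hbi : IntegrableOn (fun t : ℝ => Real.exp lam * Real.exp (-lam * t)) (Set.Ioi 0) :=
    (exp_neg_integrableOn_Ioi 0 hlam).const_mul _
  have hb : ∀ n, ∀ᵐ t ∂(volume.restrict (Set.Ioi (0 : ℝ))),
      ‖f (⌊t / h n⌋₊ * h n)‖ ≤ Real.exp lam * Real.exp (-lam * t) := by
    intro n
    refine (ae_restrict_iff' measurableSet_Ioi).2 (Eventually.of_forall fun t ht => ?_)
    refine (hbound _ (mul_nonneg (Nat.cast_nonneg _) (hpos n).le)).trans ?_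
    rw [← Real.exp_add, Real.exp_le_exp]
    have h1 : t < (⌊t / h n⌋₊ + 1) * h n := (div_lt_iff₀ (hpos n)).1 (Nat.lt_floor_add_one _)
    have h2 := hle n
    have h3 : t - 1 ≤ ⌊t / h n⌋₊ * h n := by linarith
    nlinarith
  have hI : ∀ n, IntegrableOn (fun t : ℝ => f (⌊t / h n⌋₊ * h n)) (Set.Ioi 0) := fun n =>
    Integrable.mono' hbi (hmeas n).aestronglyMeasurable (hb n)
  simp_rw [fun n => (integral_comp_floor (hpos n) (hI n)).symm]
  refine tendsto_integral_of_dominated_convergence _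
    (fun n => (hmeas n).aestronglyMeasurable) hbi hb ?_
  refine (ae_restrict_iff' measurableSet_Ioi).2 (Eventually.of_forall fun t ht => ?_)
  refine (hf.tendsto t).comp ?_
  have h1 : ∀ n, (⌊t / h n⌋₊ : ℝ) * h n ≤ t := fun n =>
    (le_div_iff₀ (hpos n)).1 (Nat.floor_le (div_nonneg (le_of_lt ht) (hpos n).le))
  have h2 : ∀ n, t - h n ≤ (⌊t / h n⌋₊ : ℝ) * h n := fun n => by
    have : t < (⌊t / h n⌋₊ + 1) * h n := (div_lt_iff₀ (hpos n)).1 (Nat.lt_floor_add_one _)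
    linarith
  refine tendsto_of_tendsto_of_tendsto_of_le_of_le ?_ tendsto_const_nhds h2 h1
  simpa using hlim.const_sub t

end RiemannSum

/-! ### The resolvent on the diagonal and the matrix `R_λ`. -/

section Resolvent

open Filter

variable {E : Type*} [Fintype E] [DecidableEq E] {Q : Matrix E E ℝ} {π : E → ℝ} {lam : ℝ}

/-- The resolvent `∫₀^∞ e^{-λ t} Q_t(y, x)² dt` of two independent chains, from `(y, y)` to
`(x, x)`. -/
noncomputable def diagResolvent (Q : Matrix E E ℝ) (lam : ℝ) (y x : E) : ℝ :=
  ∫ t in Set.Ioi (0 : ℝ), Real.exp (-lam * t) * semigroup Q t y x ^ 2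

lemma semigroup_apply_nonneg (hQ : Q ∈ rowStochastic ℝ E) {t : ℝ} (ht : 0 ≤ t) (a b : E) :
    0 ≤ semigroup Q t a b :=
  nonneg_of_mem_rowStochastic (semigroup_mem_rowStochastic hQ ht)

lemma semigroup_apply_le_one (hQ : Q ∈ rowStochastic ℝ E) {t : ℝ} (ht : 0 ≤ t) (a b : E) :
    semigroup Q t a b ≤ 1 :=
  le_one_of_mem_rowStochastic (semigroup_mem_rowStochastic hQ ht)

lemma abs_diagResolvent_integrand_le (hQ : Q ∈ rowStochastic ℝ E) (y x : E) {t : ℝ} (ht : 0 ≤ t) :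
    |Real.exp (-lam * t) * semigroup Q t y x ^ 2| ≤ Real.exp (-lam * t) := by
  have h0 := semigroup_apply_nonneg hQ ht y x
  have h1 := semigroup_apply_le_one hQ ht y x
  rw [abs_of_nonneg (by positivity)]
  exact mul_le_of_le_one_right (Real.exp_nonneg _) (pow_le_one₀ h0 h1)

lemma continuous_diagResolvent_integrand (Q : Matrix E E ℝ) (lam : ℝ) (y x : E) :
    Continuous fun t : ℝ => Real.exp (-lam * t) * semigroup Q t y x ^ 2 :=
  (by fun_prop : Continuous fun t : ℝ => Real.exp (-lam * t)).mul
    ((continuous_semigroup_apply Q y x).pow 2)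

lemma integrableOn_diagResolvent_integrand (hQ : Q ∈ rowStochastic ℝ E) (hlam : 0 < lam)
    (y x : E) :
    IntegrableOn (fun t : ℝ => Real.exp (-lam * t) * semigroup Q t y x ^ 2) (Set.Ioi 0) :=
  Integrable.mono' (exp_neg_integrableOn_Ioi 0 hlam)
    (continuous_diagResolvent_integrand Q lam y x).aestronglyMeasurable
    ((ae_restrict_iff' measurableSet_Ioi).2 (Eventually.of_forall fun _ ht =>
      abs_diagResolvent_integrand_le hQ y x (le_of_lt ht)))

lemma RIntegrand_nonneg (hQ : Q ∈ rowStochastic ℝ E) (x y : E) {t : ℝ} (ht : 0 ≤ t) :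
    0 ≤ RIntegrand Q lam x y t :=
  mul_nonneg (mul_nonneg (Real.exp_nonneg _) (semigroup_apply_nonneg hQ ht y x))
    (nonneg_of_mem_rowStochastic (mul_mem hQ (semigroup_mem_rowStochastic hQ ht)))

lemma integrableOn_RIntegrand (hQ : Q ∈ rowStochastic ℝ E) (hlam : 0 < lam) (x y : E) :
    IntegrableOn (RIntegrand Q lam x y) (Set.Ioi 0) := by
  have hcont : Continuous (RIntegrand Q lam x y) := by
    have h1 : Continuous fun t : ℝ => (Q * semigroup Q t) y x := by
      simp_rw [Matrix.mul_apply]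
      exact continuous_finsetSum _ fun c _ => (continuous_semigroup_apply Q c x).const_mul _
    exact ((by fun_prop : Continuous fun t : ℝ => Real.exp (-lam * t)).mul
      (continuous_semigroup_apply Q y x)).mul h1
  refine Integrable.mono' (exp_neg_integrableOn_Ioi 0 hlam) hcont.aestronglyMeasurable
    ((ae_restrict_iff' measurableSet_Ioi).2 (Eventually.of_forall fun t ht => ?_))
  have ht : 0 ≤ t := le_of_lt ht
  have h2 : (Q * semigroup Q t) y x ≤ 1 :=
    le_one_of_mem_rowStochastic (mul_mem hQ (semigroup_mem_rowStochastic hQ ht))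
  rw [Real.norm_of_nonneg (RIntegrand_nonneg hQ x y ht), RIntegrand]
  refine (mul_le_of_le_one_right ?_ h2).trans
    (mul_le_of_le_one_right (Real.exp_nonneg _) (semigroup_apply_le_one hQ ht y x))
  exact mul_nonneg (Real.exp_nonneg _) (semigroup_apply_nonneg hQ ht y x)

/-- Integration by parts, based on `d/dt Q_t(y, x)² = 2 Q_t(y, x) (Q Q_t - Q_t)(y, x)`. -/
lemma one_add_two_mul_integral_RIntegrand (hQ : Q ∈ rowStochastic ℝ E) (hlam : 0 < lam)
    (x y : E) :
    (1 : Matrix E E ℝ) x y + 2 * ∫ t in Set.Ioi (0 : ℝ), RIntegrand Q lam x y t =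
      (2 + lam) * diagResolvent Q lam y x := by
  have hderiv : ∀ t ∈ Set.Ici (0 : ℝ),
      HasDerivAt (fun t : ℝ => Real.exp (-lam * t) * semigroup Q t y x ^ 2)
        (2 * RIntegrand Q lam x y t
          - (2 + lam) * (Real.exp (-lam * t) * semigroup Q t y x ^ 2)) t := by
    intro t _
    have h1 : HasDerivAt (fun t : ℝ => Real.exp (-lam * t)) (Real.exp (-lam * t) * -lam) t := by
      simpa using ((hasDerivAt_id t).const_mul (-lam)).exp
    convert! h1.mul ((hasDerivAt_semigroup_apply Q t y x).pow 2) using 1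
    simp only [RIntegrand, Pi.pow_apply]
    ring
  have hI1 := (integrableOn_RIntegrand hQ hlam x y).const_mul 2
  have hI2 := (integrableOn_diagResolvent_integrand hQ hlam y x).const_mul (2 + lam)
  have hlim : Tendsto (fun t : ℝ => Real.exp (-lam * t) * semigroup Q t y x ^ 2) atTop (𝓝 0) := by
    have h1 : Tendsto (fun t : ℝ => Real.exp (-lam * t)) atTop (𝓝 0) := by
      refine Real.tendsto_exp_atBot.comp ?_
      exact tendsto_id.const_mul_atTop_of_neg (by linarith)
    refine squeeze_zero_norm' ?_ h1
    filter_upwards [eventually_ge_atTop 0] with t ht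
    exact abs_diagResolvent_integrand_le hQ y x ht
  have h := integral_Ioi_of_hasDerivAt_of_tendsto' hderiv (hI1.sub hI2) hlim
  rw [integral_sub hI1 hI2, integral_const_mul, integral_const_mul] at h
  -- The boundary term at `t = 0` is `Q_0(y,x)²`, and `δ² = δ`.
  have h0 : (1 : Matrix E E ℝ) x y = (1 : Matrix E E ℝ) y x ^ 2 := by
    rw [Matrix.one_apply, Matrix.one_apply]
    by_cases hxy : x = y
    · simp [hxy]
    · simp [hxy, Ne.symm hxy]
  rw [semigroup_zero, ← h0] at h
  simp only [mul_zero, Real.exp_zero, one_mul] at h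
  rw [diagResolvent]
  linarith

lemma R_nonneg (hQ : IsReversibleKernel Q π) (lam : ℝ) (x y : E) : 0 ≤ R Q π lam x y := by
  rw [R, Matrix.of_apply]
  have h := div_nonneg (hQ.pos y).le (hQ.pos x).le
  refine mul_nonneg (by positivity) (setIntegral_nonneg measurableSet_Ioi fun t ht => ?_)
  exact RIntegrand_nonneg hQ.stochastic x y (le_of_lt ht)

/-- Exchanging `x` and `y` multiplies each of the two kernel factors by `π(y)/π(x)`; the square of
this ratio compensates the inverted prefactor. -/
lemma R_isSymm (hQ : IsReversibleKernel Q π) (lam : ℝ) : (R Q π lam).IsSymm := by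
  ext x y
  simp only [transpose_apply, R, Matrix.of_apply]
  have hx := (hQ.pos x).ne'
  have hy := (hQ.pos y).ne'
  have h : ∀ t, RIntegrand Q lam y x t = (π y / π x) ^ 2 * RIntegrand Q lam x y t := by
    intro t
    have h1 : semigroup Q t x y = π y / π x * semigroup Q t y x := by
      field_simp
      linarith [hQ.semigroup_reversible t x y]
    have h2 : (Q * semigroup Q t) x y = π y / π x * (Q * semigroup Q t) y x := by
      field_simp
      linarith [hQ.mul_semigroup_reversible t x y]
    rw [RIntegrand, RIntegrand, h1, h2]
    ring
  simp_rw [h, integral_const_mul]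
  field_simp

end Resolvent

end MeetingTimes

namespace MeetingTimes

/-! ### First meeting on a grid. -/

section GridMeeting

open Filter

variable {E : Type*} [Fintype E] [DecidableEq E] [MeasurableSpace E] [DiscreteMeasurableSpace E]
  {Q : Matrix E E ℝ} {π : E → ℝ} {Ω : Type*} [MeasurableSpace Ω] {P : Measure Ω}
  [IsProbabilityMeasure P] {X Y : ℝ≥0 → Ω → E}

namespace IsRateOneChain

omit [DiscreteMeasurableSpace E] [IsProbabilityMeasure P] in
/-- The Markov property at the last point of a grid of mesh `h`. -/
lemma measureReal_grid_inter (hX : IsRateOneChain Q π P X) (h s : ℝ≥0) (j : ℕ)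
    (a : Fin (j + 1) → E) (w : E) :
    P.real {ω | (∀ i : Fin (j + 1), X (i * h) ω = a i) ∧ X (j * h + s) ω = w} =
      P.real {ω | ∀ i : Fin (j + 1), X (i * h) ω = a i} * semigroup Q s (a (Fin.last j)) w := by
  have h1 := hX.law j (fun i => i * h) a (by simp)
    (fun i i' hi => by
      have : ((i : ℕ) : ℝ≥0) ≤ (i' : ℕ) := by exact_mod_cast hi
      exact mul_le_mul_left this h)
  -- With `j h + s` appended to the grid, the product in the law gains exactly one factor.
  have h2 := hX.law (j + 1) (Fin.snoc (α := fun _ => ℝ≥0) (fun i : Fin (j + 1) => i * h) (j * h + s))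
    (Fin.snoc (α := fun _ => E) a w)
    (by rw [← Fin.castSucc_zero, Fin.snoc_castSucc]; simp)
    (by
      rw [Fin.monotone_iff_le_succ]
      intro i
      rw [Fin.snoc_castSucc]
      refine Fin.lastCases ?_ (fun i => ?_) i
      · rw [Fin.succ_last, Fin.snoc_last]
        simp
      · rw [Fin.succ_castSucc, Fin.snoc_castSucc]
        gcongr
        simp)
  rw [Fin.prod_univ_castSucc] at h2
  simp only [Fin.succ_last, Fin.snoc_last, Fin.snoc_castSucc, Fin.succ_castSucc,
    Fin.forall_fin_succ'] at h2
  rw [← Fin.castSucc_zero, Fin.snoc_castSucc, ← mul_assoc] at h2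
  simp only [Fin.forall_fin_succ'] at h1 ⊢
  rw [h1, h2]
  simp

lemma measureReal_eq (hQ : IsReversibleKernel Q π) (hX : IsRateOneChain Q π P X)
    (t : ℝ≥0) (x : E) : P.real {ω | X t ω = x} = π x := by
  have h1 : ∀ a, P.real (X 0 ⁻¹' {a} ∩ {ω | X t ω = x}) = π a * semigroup Q t a x := by
    intro a
    have h := hX.measureReal_grid_inter 0 t 0 (fun _ => a) x
    have h0 := hX.law 0 (fun _ => 0) (fun _ => a) rfl monotone_const
    simp only [mul_zero, forall_const, zero_add] at h
    simp only [forall_const, Finset.univ_eq_empty, Finset.prod_empty, mul_one] at h0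
    rw [h0] at h
    exact h
  rw [← hQ.sum_mul_semigroup t x, ← Finset.sum_congr rfl fun a _ => h1 a]
  have h2 := sum_measureReal_preimage_singleton (μ := P.restrict {ω | X t ω = x}) (f := X 0)
    Finset.univ (fun a _ => hX.measurable 0 (measurableSet_singleton a))
  simp only [measureReal_restrict_apply (hX.measurable 0 (measurableSet_singleton _))] at h2
  rw [h2]
  simp

end IsRateOneChain

/-- The event that `X` and `Y`, observed at the multiples of `h`, meet for the first time at `j h`,
at the point `y`. -/
def gridMeeting (X Y : ℝ≥0 → Ω → E) (h : ℝ≥0) (j : ℕ) (y : E) : Set Ω :=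
  {ω | X (j * h) ω = y ∧ Y (j * h) ω = y ∧ ∀ i < j, X (i * h) ω ≠ Y (i * h) ω}

omit [Fintype E] [DecidableEq E] [MeasurableSpace E] [DiscreteMeasurableSpace E]
  [MeasurableSpace Ω] in
lemma gridMeeting_unique {h : ℝ≥0} {i j : ℕ} {y z : E} {ω : Ω} (hi : ω ∈ gridMeeting X Y h i y)
    (hj : ω ∈ gridMeeting X Y h j z) : i = j ∧ y = z := by
  have hij : i = j := by
    rcases lt_trichotomy i j with hlt | heq | hlt
    · exact absurd (hi.1.trans hi.2.1.symm) (hj.2.2 i hlt)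
    · exact heq
    · exact absurd (hj.1.trans hj.2.1.symm) (hi.2.2 j hlt)
  exact ⟨hij, by rw [← hi.1, hij, hj.1]⟩

omit [Fintype E] [DecidableEq E] [MeasurableSpace E] [DiscreteMeasurableSpace E]
  [MeasurableSpace Ω] in
lemma exists_mem_gridMeeting {h : ℝ≥0} {k : ℕ} {ω : Ω} (hk : X (k * h) ω = Y (k * h) ω) :
    ∃ j ≤ k, ∃ y, ω ∈ gridMeeting X Y h j y := by
  classical
  have hex : ∃ j : ℕ, X (j * h) ω = Y (j * h) ω := ⟨k, hk⟩
  exact ⟨Nat.find hex, Nat.find_min' hex hk, _, rfl, (Nat.find_spec hex).symm,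
    fun i hi => Nat.find_min hex hi⟩

omit [DecidableEq E] in
lemma measurableSet_gridMeeting (hX : ∀ t, Measurable (X t)) (hY : ∀ t, Measurable (Y t))
    (h : ℝ≥0) (j : ℕ) (y : E) : MeasurableSet (gridMeeting X Y h j y) := by
  have hne : ∀ t, MeasurableSet {ω | X t ω ≠ Y t ω} := fun t =>
    ((hX t).prodMk (hY t)) (MeasurableSet.of_discrete (s := {p : E × E | p.1 ≠ p.2}))
  have h3 : MeasurableSet {ω | ∀ i < j, X (i * h) ω ≠ Y (i * h) ω} := by
    simp only [Set.ofPred_forall]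
    exact MeasurableSet.iInter fun i => MeasurableSet.iInter fun _ => hne _
  exact (hX _ (measurableSet_singleton y)).inter ((hY _ (measurableSet_singleton y)).inter h3)

variable (hX : IsRateOneChain Q π P X) (hY : IsRateOneChain Q π P Y)
  (hXY : IndepFun (fun ω t => X t ω) (fun ω t => Y t ω) P)

include hXY in
omit [Fintype E] [DecidableEq E] [DiscreteMeasurableSpace E] [IsProbabilityMeasure P] in
lemma measureReal_inter_of_indepFun {A B : Set (ℝ≥0 → E)} (hA : MeasurableSet A)
    (hB : MeasurableSet B) :
    P.real {ω | (fun t => X t ω) ∈ A ∧ (fun t => Y t ω) ∈ B} =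
      P.real {ω | (fun t => X t ω) ∈ A} * P.real {ω | (fun t => Y t ω) ∈ B} := by
  have h := hXY.measure_inter_preimage_eq_mul A B hA hB
  simp only [measureReal_def, ← ENNReal.toReal_mul]
  exact congrArg ENNReal.toReal h

omit [Fintype E] [DecidableEq E] in
lemma measurableSet_eval_eq (t : ℝ≥0) (x : E) : MeasurableSet {f : ℝ≥0 → E | f t = x} :=
  (measurable_pi_apply t : Measurable fun f : ℝ≥0 → E => f t) (measurableSet_singleton x)

omit [Fintype E] [DecidableEq E] in
lemma measurableSet_grid (h : ℝ≥0) (j : ℕ) (a : Fin (j + 1) → E) :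
    MeasurableSet {f : ℝ≥0 → E | ∀ i : Fin (j + 1), f (i * h) = a i} := by
  simp only [Set.ofPred_forall]
  exact MeasurableSet.iInter fun i => measurableSet_eval_eq _ (a i)

-- Independence is used both with and without the constraint at the later time; the Markov property
-- of each chain accounts for the ratio.
include hX hY hXY in
omit [IsProbabilityMeasure P] in
lemma measureReal_pair_grid_inter (h s : ℝ≥0) (j : ℕ) (a b : Fin (j + 1) → E) (x : E) :
    P.real {ω | ((∀ i : Fin (j + 1), X (i * h) ω = a i) ∧ ∀ i : Fin (j + 1), Y (i * h) ω = b i) ∧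
        X (j * h + s) ω = x ∧ Y (j * h + s) ω = x} =
      P.real {ω | (∀ i : Fin (j + 1), X (i * h) ω = a i) ∧
        ∀ i : Fin (j + 1), Y (i * h) ω = b i} *
        (semigroup Q s (a (Fin.last j)) x * semigroup Q s (b (Fin.last j)) x) := by
  have hm : ∀ c : Fin (j + 1) → E, MeasurableSet
      {f : ℝ≥0 → E | (∀ i : Fin (j + 1), f (i * h) = c i) ∧ f (j * h + s) = x} := fun c =>
    (measurableSet_grid h j c).inter (measurableSet_eval_eq _ x)
  have h1 := measureReal_inter_of_indepFun hXY (hm a) (hm b)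
  have h2 := measureReal_inter_of_indepFun hXY (measurableSet_grid h j a) (measurableSet_grid h j b)
  simp only [Set.mem_ofPred_eq] at h1 h2
  rw [hX.measureReal_grid_inter, hY.measureReal_grid_inter] at h1
  rw [h2, mul_mul_mul_comm, ← h1]
  congr 1
  ext ω
  simp only [Set.mem_ofPred_eq]
  tauto

include hX hY hXY in
/-- The strong Markov property at the first meeting time on a grid. -/
lemma measureReal_gridMeeting_inter (h s : ℝ≥0) (j : ℕ) (y x : E) :
    P.real (gridMeeting X Y h j y ∩ {ω | X (j * h + s) ω = x ∧ Y (j * h + s) ω = x}) =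
      P.real (gridMeeting X Y h j y) * semigroup Q s y x ^ 2 := by
  classical
  set V : Ω → (Fin (j + 1) → E) × (Fin (j + 1) → E) :=
    fun ω => (fun i => X (i * h) ω, fun i => Y (i * h) ω) with hV
  set T : Set Ω := {ω | X (j * h + s) ω = x ∧ Y (j * h + s) ω = x} with hT
  have hVm : Measurable V :=
    (measurable_pi_lambda _ fun i => hX.measurable _).prodMk
      (measurable_pi_lambda _ fun i => hY.measurable _)
  -- The pairs of grid trajectories that realise the event. All of them end at `(y, y)`, so the
  -- transition factor is common to the whole sum.
  set S : Finset ((Fin (j + 1) → E) × (Fin (j + 1) → E)) := Finset.univ.filter fun p =>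
    p.1 (Fin.last j) = y ∧ p.2 (Fin.last j) = y ∧ ∀ i : Fin j, p.1 i.castSucc ≠ p.2 i.castSucc
    with hS
  have hpre : gridMeeting X Y h j y = V ⁻¹' S := by
    ext ω
    simp only [gridMeeting, Set.mem_ofPred_eq, hS, Set.mem_preimage, Finset.coe_filter,
      Finset.mem_univ, true_and, hV, Fin.val_last, Fin.val_castSucc]
    refine and_congr_right fun _ => and_congr_right fun _ => ?_
    exact ⟨fun H i => H i i.2, fun H i hi => H ⟨i, hi⟩⟩
  have hsing : ∀ p, MeasurableSet (V ⁻¹' {p}) := fun p => hVm (measurableSet_singleton p)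
  have hsum : ∀ μ : Measure Ω, IsFiniteMeasure μ →
      μ.real (gridMeeting X Y h j y) = ∑ p ∈ S, μ.real (V ⁻¹' {p}) := by
    intro μ _
    rw [hpre, sum_measureReal_preimage_singleton S fun p _ => hsing p]
  have hg := measurableSet_gridMeeting hX.measurable hY.measurable h j y
  rw [← measureReal_restrict_apply hg, hsum _ inferInstance, hsum P inferInstance,
    Finset.sum_mul]
  refine Finset.sum_congr rfl fun p hp => ?_
  rw [measureReal_restrict_apply (hsing p)]
  have hp' := (Finset.mem_filter.1 hp).2
  have hset : V ⁻¹' {p} = {ω | (∀ i : Fin (j + 1), X (i * h) ω = p.1 i) ∧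
      ∀ i : Fin (j + 1), Y (i * h) ω = p.2 i} := by
    ext ω
    simp only [hV, Set.mem_preimage, Set.mem_singleton_iff, Prod.ext_iff, funext_iff,
      Set.mem_ofPred_eq]
  have h1 := measureReal_pair_grid_inter hX hY hXY h s j p.1 p.2 x
  rw [hp'.1, hp'.2.1, ← hset, ← sq] at h1
  rw [← h1, hset]
  rfl

include hX hY hXY in
/-- First-passage decomposition on a grid of mesh `h`. -/
lemma sum_measureReal_gridMeeting_mul (hQ : IsReversibleKernel Q π) (h : ℝ≥0) (k : ℕ) (x : E) :
    ∑ j ∈ Finset.range (k + 1), ∑ y, P.real (gridMeeting X Y h j y) *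
      semigroup Q ((k - j : ℕ) * h) y x ^ 2 = π x ^ 2 := by
  set T : Set Ω := {ω | X (k * h) ω = x ∧ Y (k * h) ω = x} with hT
  have hPT : P.real T = π x ^ 2 := by
    have hm : MeasurableSet {f : ℝ≥0 → E | f (k * h) = x} :=
      measurableSet_eval_eq _ x
    have h1 := measureReal_inter_of_indepFun hXY hm hm
    simp only [Set.mem_ofPred_eq] at h1
    rw [hX.measureReal_eq hQ, hY.measureReal_eq hQ, ← sq] at h1
    exact h1
  have hTm : MeasurableSet T := (hX.measurable _ (measurableSet_singleton x)).inter
    (hY.measurable _ (measurableSet_singleton x))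
  have hterm : ∀ j ∈ Finset.range (k + 1), ∀ y,
      P.real (gridMeeting X Y h j y) * semigroup Q ((k - j : ℕ) * h) y x ^ 2 =
        P.real (gridMeeting X Y h j y ∩ T) := by
    intro j hj y
    have hjk : j ≤ k := Nat.lt_succ_iff.1 (Finset.mem_range.1 hj)
    have hk : (k : ℝ≥0) * h = j * h + (k - j : ℕ) * h := by
      rw [← add_mul, ← Nat.cast_add, Nat.add_sub_cancel' hjk]
    have h1 := measureReal_gridMeeting_inter hX hY hXY h ((k - j : ℕ) * h) j y x
    rw [← hk] at h1
    rw [hT, h1, NNReal.coe_mul, NNReal.coe_natCast]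
  rw [Finset.sum_congr rfl fun j hj => Finset.sum_congr rfl fun y _ => hterm j hj y,
    ← Finset.sum_product', ← hPT, ← measureReal_biUnion_finset]
  -- The chains agree at time `k h` on `T`, so a first grid meeting has occurred at some `j ≤ k`.
  · congr 1
    ext ω
    simp only [Set.mem_iUnion, exists_prop, Finset.mem_product, Finset.mem_range, Finset.mem_univ,
      and_true, Set.mem_inter_iff, Prod.exists]
    constructor
    · rintro ⟨_, _, _, _, hω⟩
      exact hω
    · intro hω
      obtain ⟨j, hj, y, hy⟩ := exists_mem_gridMeeting (X := X) (Y := Y) (h := h) (k := k)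
        (hω.1.trans hω.2.symm)
      exact ⟨j, y, Nat.lt_succ_of_le hj, hy, hω⟩
  · rintro ⟨i, y⟩ _ ⟨j, z⟩ _ hne
    refine Set.disjoint_left.2 fun ω h1 h2 => hne ?_
    obtain ⟨rfl, rfl⟩ := gridMeeting_unique h1.1 h2.1
    rfl
  · intro p _
    exact (measurableSet_gridMeeting hX.measurable hY.measurable h p.1 p.2).inter hTm

end GridMeeting

end MeetingTimes

namespace MeetingTimes

/-! ### From grid meetings to the meeting time. -/

section Limit

open Filter

variable {E : Type*} {Ω : Type*} {X Y : ℝ≥0 → Ω → E} {lam : ℝ}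

/-- The analogue of `meetingWeight` for the first meeting at a multiple of `h`. -/
noncomputable def gridWeight (X Y : ℝ≥0 → Ω → E) (lam : ℝ) (h : ℝ≥0) (y : E) (ω : Ω) : ℝ :=
  ∑' j : ℕ, (gridMeeting X Y h j y).indicator (fun _ => Real.exp (-lam * h) ^ j) ω

lemma gridWeight_of_mem {h : ℝ≥0} {j : ℕ} {y : E} {ω : Ω} (hω : ω ∈ gridMeeting X Y h j y) :
    gridWeight X Y lam h y ω = Real.exp (-lam * h) ^ j := by
  rw [gridWeight, tsum_eq_single j, Set.indicator_of_mem hω]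
  exact fun i hi => Set.indicator_of_notMem (fun hmem => hi (gridMeeting_unique hmem hω).1) _

lemma gridWeight_of_forall_notMem {h : ℝ≥0} {y : E} {ω : Ω}
    (hω : ∀ j, ω ∉ gridMeeting X Y h j y) : gridWeight X Y lam h y ω = 0 := by
  simp [gridWeight, hω]

lemma norm_gridWeight_le (hlam : 0 < lam) (h : ℝ≥0) (y : E) (ω : Ω) :
    ‖gridWeight X Y lam h y ω‖ ≤ 1 := by
  by_cases hω : ∃ j, ω ∈ gridMeeting X Y h j y
  · obtain ⟨j, hj⟩ := hω
    rw [gridWeight_of_mem hj, norm_pow, Real.norm_of_nonneg (Real.exp_nonneg _)]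
    refine pow_le_one₀ (Real.exp_nonneg _) (Real.exp_le_one_iff.2 ?_)
    have := mul_nonneg hlam.le h.coe_nonneg
    linarith
  · push Not at hω
    simp [gridWeight_of_forall_notMem hω]

lemma meetingTime_eq_coe_sInf {ω : Ω} (hne : {t | X t ω = Y t ω}.Nonempty) :
    meetingTime X Y ω = (sInf {t | X t ω = Y t ω} : ℝ≥0) := by
  rw [meetingTime, sInf_image, ENNReal.coe_sInf hne]

/-- The meeting time of two right-continuous paths is attained. -/
lemma eq_at_sInf {ω : Ω} (hXr : ∀ t, ∀ᶠ s in 𝓝[>] t, X s ω = X t ω)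
    (hYr : ∀ t, ∀ᶠ s in 𝓝[>] t, Y s ω = Y t ω) (hne : {t | X t ω = Y t ω}.Nonempty) :
    X (sInf {t | X t ω = Y t ω}) ω = Y (sInf {t | X t ω = Y t ω}) ω := by
  set T := {t | X t ω = Y t ω} with hT
  by_contra hmem
  obtain ⟨u, hu, hsub⟩ := (mem_nhdsGT_iff_exists_Ioo_subset).1 ((hXr (sInf T)).and (hYr (sInf T)))
  refine absurd (le_csInf hne fun t ht => ?_) (not_le.2 hu)
  by_contra hlt
  have h1 : sInf T ≤ t := csInf_le (OrderBot.bddBelow T) ht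
  have h2 : sInf T ≠ t := fun h => hmem (h ▸ ht)
  have h3 := hsub ⟨lt_of_le_of_ne h1 h2, not_le.1 hlt⟩
  exact hmem (h3.1.symm.trans ((show X t ω = Y t ω from ht).trans h3.2))

/-- The paths meet at `m` and stay constant on some `[m, u)`. Once the first grid point at or after
`m` lies below `u`, it is the first grid meeting and has the same location. -/
lemma tendsto_gridWeight {ω : Ω} (hXr : ∀ t, ∀ᶠ s in 𝓝[>] t, X s ω = X t ω)
    (hYr : ∀ t, ∀ᶠ s in 𝓝[>] t, Y s ω = Y t ω) (y : E) {h : ℕ → ℝ≥0} (hpos : ∀ n, 0 < h n)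
    (hlim : Tendsto h atTop (𝓝 0)) :
    Tendsto (fun n => gridWeight X Y lam (h n) y ω) atTop (𝓝 (meetingWeight X Y lam y ω)) := by
  rcases Set.eq_empty_or_nonempty {t | X t ω = Y t ω} with he | hne
  · have hno : ∀ n, gridWeight X Y lam (h n) y ω = 0 := fun n =>
      gridWeight_of_forall_notMem fun j hj =>
        (Set.eq_empty_iff_forall_notMem.1 he (j * h n)) (hj.1.trans hj.2.1.symm)
    have hM : meetingWeight X Y lam y ω = 0 := by
      rw [meetingWeight, meetingTime, he]
      simp
    simp only [hno, hM, tendsto_const_nhds]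
  · have hM := meetingTime_eq_coe_sInf hne
    have hmem := eq_at_sInf hXr hYr hne
    have hle : ∀ t, X t ω = Y t ω → sInf {t | X t ω = Y t ω} ≤ t := fun t ht =>
      csInf_le (OrderBot.bddBelow _) ht
    set m : ℝ≥0 := sInf {t | X t ω = Y t ω} with hm
    obtain ⟨u, hu, hsub⟩ := (mem_nhdsGT_iff_exists_Ioo_subset).1 ((hXr m).and (hYr m))
    have hconst : ∀ t, m ≤ t → t < u → X t ω = X m ω ∧ Y t ω = Y m ω := by
      intro t hmt htu
      rcases hmt.eq_or_lt with rfl | hlt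
      · exact ⟨rfl, rfl⟩
      · exact hsub ⟨hlt, htu⟩
    -- The ceiling makes all earlier grid points strictly smaller than `m`, so none of them is a
    -- meeting.
    set k : ℕ → ℕ := fun n => ⌈m / h n⌉₊ with hk
    have hk1 : ∀ n, m ≤ k n * h n := fun n => (div_le_iff₀ (hpos n)).1 (Nat.le_ceil _)
    have hk2 : ∀ n, (k n : ℝ≥0) * h n < m + h n := fun n => by
      have := Nat.ceil_lt_add_one (a := m / h n) (by positivity)
      calc (k n : ℝ≥0) * h n < (m / h n + 1) * h n := mul_lt_mul_of_pos_right this (hpos n)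
        _ = m + h n := by rw [add_mul, one_mul, div_mul_cancel₀ _ (hpos n).ne']
    have hkh : Tendsto (fun n => (k n : ℝ≥0) * h n) atTop (𝓝 m) := by
      refine tendsto_of_tendsto_of_tendsto_of_le_of_le tendsto_const_nhds ?_ hk1
        fun n => (hk2 n).le
      simpa using hlim.const_add m
    have hgrid : ∀ᶠ n in atTop, ω ∈ gridMeeting X Y (h n) (k n) (X m ω) := by
      filter_upwards [hkh.eventually (gt_mem_nhds hu)] with n hn
      obtain ⟨h1, h2⟩ := hconst _ (hk1 n) hn
      refine ⟨h1, h2.trans hmem.symm, fun i hi heq => ?_⟩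
      have h3 : (i : ℝ≥0) < m / h n := Nat.lt_ceil.1 hi
      exact absurd (hle _ heq) (not_le.2 ((lt_div_iff₀ (hpos n)).1 h3))
    by_cases hy : X m ω = y
    · have hW : meetingWeight X Y lam y ω = Real.exp (-lam * m) := by
        simp [meetingWeight, hM, hy]
      rw [hW]
      have h1 : Tendsto (fun n => Real.exp (-lam * ((k n * h n : ℝ≥0) : ℝ))) atTop
          (𝓝 (Real.exp (-lam * m))) :=
        (Real.continuous_exp.tendsto _).comp
          (((NNReal.continuous_coe.tendsto m).comp hkh).const_mul (-lam))
      refine h1.congr' ?_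
      filter_upwards [hgrid] with n hn
      rw [gridWeight_of_mem (hy ▸ hn), ← Real.exp_nat_mul]
      congr 1
      push_cast
      ring
    · have hW : meetingWeight X Y lam y ω = 0 := by simp [meetingWeight, hM, hy]
      rw [hW]
      refine tendsto_const_nhds.congr' ?_
      filter_upwards [hgrid] with n hn
      exact (gridWeight_of_forall_notMem fun j hj => hy (gridMeeting_unique hn hj).2).symm

lemma meetingLaplace_nonneg [MeasurableSpace Ω] (P : Measure Ω) (X Y : ℝ≥0 → Ω → E) (lam : ℝ)
    (x : E) : 0 ≤ meetingLaplace P X Y lam x := by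
  refine integral_nonneg fun ω => ?_
  simp only [meetingWeight, Pi.zero_apply]
  split_ifs
  · exact Real.exp_nonneg _
  · exact le_rfl

section Integral

variable [Fintype E] [MeasurableSpace E] [DiscreteMeasurableSpace E] [MeasurableSpace Ω]
  {P : Measure Ω} [IsProbabilityMeasure P]

omit [IsProbabilityMeasure P] in
lemma measurable_gridWeight (hX : ∀ t, Measurable (X t)) (hY : ∀ t, Measurable (Y t)) (lam : ℝ)
    (h : ℝ≥0) (y : E) : Measurable (gridWeight X Y lam h y) :=
  Measurable.tsum fun j => measurable_const.indicator (measurableSet_gridMeeting hX hY h j y)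

lemma exp_neg_mul_lt_one {lam h : ℝ} (hlam : 0 < lam) (hh : 0 < h) :
    Real.exp (-lam * h) < 1 :=
  Real.exp_zero ▸ Real.exp_lt_exp.2 (by nlinarith)

lemma summable_pow_mul_measureReal (P : Measure Ω) [IsProbabilityMeasure P] {r : ℝ} (hr0 : 0 ≤ r)
    (hr1 : r < 1) (s : ℕ → Set Ω) : Summable fun j => r ^ j * P.real (s j) :=
  (summable_geometric_of_lt_one hr0 hr1).of_nonneg_of_le
    (fun j => mul_nonneg (pow_nonneg hr0 j) measureReal_nonneg)
    fun j => mul_le_of_le_one_right (pow_nonneg hr0 j) measureReal_le_one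

lemma integral_gridWeight (hX : ∀ t, Measurable (X t)) (hY : ∀ t, Measurable (Y t))
    (hlam : 0 < lam) {h : ℝ≥0} (hh : 0 < h) (y : E) :
    ∫ ω, gridWeight X Y lam h y ω ∂P =
      ∑' j : ℕ, Real.exp (-lam * h) ^ j * P.real (gridMeeting X Y h j y) := by
  have hm := fun j => measurableSet_gridMeeting hX hY h j y
  have hint : ∀ j, ∫ ω, (gridMeeting X Y h j y).indicator
      (fun _ => Real.exp (-lam * h) ^ j) ω ∂P =
        Real.exp (-lam * h) ^ j * P.real (gridMeeting X Y h j y) := fun j => by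
    rw [integral_indicator_const _ (hm j), smul_eq_mul, mul_comm]
  simp only [gridWeight]
  rw [← integral_tsum_of_summable_integral_norm
    (fun j => (integrable_const _).indicator (hm j))]
  · exact tsum_congr hint
  · have hr := exp_neg_mul_lt_one hlam (NNReal.coe_pos.2 hh)
    refine (summable_pow_mul_measureReal P (Real.exp_nonneg _) hr
      fun j => gridMeeting X Y h j y).congr fun j => ?_
    rw [← hint j]
    refine integral_congr_ae (Eventually.of_forall fun ω => ?_)
    exact (Real.norm_of_nonneg (Set.indicator_nonneg (fun _ _ => by positivity) ω)).symm

lemma tendsto_integral_gridWeight (hX : ∀ t, Measurable (X t)) (hY : ∀ t, Measurable (Y t))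
    (hXr : ∀ᵐ ω ∂P, ∀ t, ∀ᶠ s in 𝓝[>] t, X s ω = X t ω)
    (hYr : ∀ᵐ ω ∂P, ∀ t, ∀ᶠ s in 𝓝[>] t, Y s ω = Y t ω)
    (hlam : 0 < lam) (y : E) {h : ℕ → ℝ≥0} (hpos : ∀ n, 0 < h n) (hlim : Tendsto h atTop (𝓝 0)) :
    Integrable (meetingWeight X Y lam y) P ∧
      Tendsto (fun n => ∫ ω, gridWeight X Y lam (h n) y ω ∂P) atTop
        (𝓝 (meetingLaplace P X Y lam y)) := by
  have hconv : ∀ᵐ ω ∂P, Tendsto (fun n => gridWeight X Y lam (h n) y ω) atTop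
      (𝓝 (meetingWeight X Y lam y ω)) := by
    filter_upwards [hXr, hYr] with ω h1 h2
    exact tendsto_gridWeight h1 h2 y hpos hlim
  have hmeas : ∀ n, AEStronglyMeasurable (gridWeight X Y lam (h n) y) P := fun n =>
    (measurable_gridWeight hX hY lam (h n) y).aestronglyMeasurable
  constructor
  -- Measurability of `meetingWeight` is obtained only here, as an almost sure limit of grid
  -- weights.
  · refine Integrable.mono' (integrable_const (1 : ℝ))
      (aestronglyMeasurable_of_tendsto_ae atTop hmeas hconv) ?_
    filter_upwards [hconv] with ω hω
    exact le_of_tendsto hω.norm (Eventually.of_forall fun n => norm_gridWeight_le hlam _ _ _)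
  · exact tendsto_integral_of_dominated_convergence (fun _ => 1) hmeas (integrable_const _)
      (fun n => Eventually.of_forall fun ω => norm_gridWeight_le hlam _ _ _) hconv

end Integral

end Limit

/-! ### The renewal identity and the linear equation. -/

section StrongMarkov

open Filter

variable {E : Type*} [Fintype E] [DecidableEq E] [MeasurableSpace E] [DiscreteMeasurableSpace E]
  {Q : Matrix E E ℝ} {π : E → ℝ} {Ω : Type*} [MeasurableSpace Ω] {P : Measure Ω}
  [IsProbabilityMeasure P] {X Y : ℝ≥0 → Ω → E} {lam : ℝ}

/-- The left side is a Cauchy product in `r = e^{-λh}`; by the first-passage decomposition its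
`k`-th term is `r^k π(x)²`, and a geometric series remains. -/
lemma sum_integral_gridWeight_mul (hQ : IsReversibleKernel Q π) (hX : IsRateOneChain Q π P X)
    (hY : IsRateOneChain Q π P Y) (hXY : IndepFun (fun ω t => X t ω) (fun ω t => Y t ω) P)
    (hlam : 0 < lam) {h : ℝ≥0} (hh : 0 < h) (x : E) :
    ∑ y, (∫ ω, gridWeight X Y lam h y ω ∂P) *
        ∑' k : ℕ, Real.exp (-lam * (k * h)) * semigroup Q (k * h) y x ^ 2 =
      π x ^ 2 * (1 - Real.exp (-lam * h))⁻¹ := by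
  set r := Real.exp (-lam * h) with hr
  have hr0 : 0 ≤ r := Real.exp_nonneg _
  have hr1 : r < 1 := exp_neg_mul_lt_one hlam (NNReal.coe_pos.2 hh)
  have hexp : ∀ k : ℕ, Real.exp (-lam * (k * h)) = r ^ k := fun k => by
    rw [hr, ← Real.exp_nat_mul]
    congr 1
    ring
  have hf : ∀ y, Summable fun j => r ^ j * P.real (gridMeeting X Y h j y) := fun y =>
    summable_pow_mul_measureReal P hr0 hr1 _
  have hg : ∀ y, Summable fun k : ℕ => r ^ k * semigroup Q (k * h) y x ^ 2 := by
    intro y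
    refine Summable.of_norm_bounded (summable_geometric_of_lt_one hr0 hr1) fun k => ?_
    rw [← hexp]
    exact abs_diagResolvent_integrand_le hQ.stochastic y x (by positivity)
  simp only [hexp, integral_gridWeight hX.measurable hY.measurable hlam hh]
  have hcauchy := fun y => (hasSum_sum_range_mul_of_summable_norm (hf y).norm (hg y).norm)
  have hsum := hasSum_sum fun y (_ : y ∈ Finset.univ) => hcauchy y
  rw [← hsum.tsum_eq, ← tsum_geometric_of_lt_one hr0 hr1, ← tsum_mul_left]
  refine tsum_congr fun k => ?_
  rw [← sum_measureReal_gridMeeting_mul hX hY hXY hQ h k x, Finset.sum_comm, Finset.sum_mul]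
  refine Finset.sum_congr rfl fun j hj => ?_
  rw [Finset.sum_mul]
  refine Finset.sum_congr rfl fun y _ => ?_
  have hjk : j ≤ k := Nat.lt_succ_iff.1 (Finset.mem_range.1 hj)
  rw [← pow_mul_pow_sub r hjk]
  ring

/-- The limit is the inverse of the slope of `1 - e^{-λt}` at `0`. -/
lemma tendsto_mul_inv_one_sub_exp (hlam : 0 < lam) {h : ℕ → ℝ} (hpos : ∀ n, 0 < h n)
    (hlim : Tendsto h atTop (𝓝 0)) :
    Tendsto (fun n => h n * (1 - Real.exp (-lam * h n))⁻¹) atTop (𝓝 lam⁻¹) := by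
  have hd : HasDerivAt (fun t : ℝ => 1 - Real.exp (-lam * t)) lam 0 := by
    simpa using (((hasDerivAt_id (0 : ℝ)).const_mul (-lam)).exp).const_sub 1
  have h1 := (hasDerivAt_iff_tendsto_slope_zero.1 hd).comp
    (tendsto_nhdsWithin_iff.2 ⟨hlim, Eventually.of_forall fun n => (hpos n).ne'⟩)
  refine (h1.inv₀ hlam.ne').congr fun n => ?_
  simp [mul_comm]

/-- The strong Markov property at the meeting time, integrated against `e^{-λ t}`. -/
lemma sum_meetingLaplace_mul_diagResolvent (hQ : IsReversibleKernel Q π)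
    (hX : IsRateOneChain Q π P X) (hY : IsRateOneChain Q π P Y)
    (hXY : IndepFun (fun ω t => X t ω) (fun ω t => Y t ω) P) (hlam : 0 < lam) (x : E) :
    ∑ y, meetingLaplace P X Y lam y * diagResolvent Q lam y x = π x ^ 2 * lam⁻¹ := by
  set h : ℕ → ℝ≥0 := fun n => 1 / ((n : ℝ≥0) + 1) with hh
  have hpos : ∀ n, 0 < h n := fun n => by positivity
  have hlim : Tendsto h atTop (𝓝 0) := tendsto_one_div_add_atTop_nhds_zero_nat
  have hpos' : ∀ n, 0 < (h n : ℝ) := fun n => hpos n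
  have hlim' : Tendsto (fun n => (h n : ℝ)) atTop (𝓝 0) := NNReal.tendsto_coe.2 hlim
  have hle : ∀ n, (h n : ℝ) ≤ 1 := fun n => by
    have : h n ≤ 1 := div_le_one_of_le₀ (by simp) (by positivity)
    exact_mod_cast this
  have h1 := fun y => (tendsto_integral_gridWeight hX.measurable hY.measurable hX.rightContinuous
    hY.rightContinuous hlam y hpos hlim).2
  have h2 := fun y => tendsto_riemannSum hlam (continuous_diagResolvent_integrand Q lam y x)
    (fun t ht => abs_diagResolvent_integrand_le hQ.stochastic y x ht) hpos' hle hlim'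
  have h3 := tendsto_finsetSum Finset.univ fun y _ => (h1 y).mul (h2 y)
  refine tendsto_nhds_unique h3
    (((tendsto_mul_inv_one_sub_exp hlam hpos' hlim').const_mul (π x ^ 2)).congr fun n => ?_)
  -- The grid identity is multiplied by the mesh, which turns the sums over `k` into Riemann sums.
  rw [mul_left_comm, ← sum_integral_gridWeight_mul hQ hX hY hXY hlam (hpos n) x, Finset.mul_sum]
  exact Finset.sum_congr rfl fun y _ => mul_left_comm _ _ _

lemma integrable_meetingWeight (hX : IsRateOneChain Q π P X) (hY : IsRateOneChain Q π P Y)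
    (hlam : 0 < lam) (x : E) : Integrable (meetingWeight X Y lam x) P :=
  (tendsto_integral_gridWeight hX.measurable hY.measurable hX.rightContinuous
    hY.rightContinuous hlam x (h := fun n => 1 / ((n : ℝ≥0) + 1)) (fun n => by positivity)
    tendsto_one_div_add_atTop_nhds_zero_nat).1

lemma one_add_R_mulVec_F (hQ : IsReversibleKernel Q π)
    (hX : IsRateOneChain Q π P X) (hY : IsRateOneChain Q π P Y)
    (hXY : IndepFun (fun ω t => X t ω) (fun ω t => Y t ω) P) (hlam : 0 < lam) :
    (1 + R Q π lam) *ᵥ F π P X Y lam = ((2 + lam) / lam) • π := by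
  ext x
  have hx := (hQ.pos x).ne'
  have hterm : ∀ y, (1 + R Q π lam) x y * F π P X Y lam y =
      (π x)⁻¹ * ((2 + lam) * (meetingLaplace P X Y lam y * diagResolvent Q lam y x)) := by
    intro y
    have hy := (hQ.pos y).ne'
    have h1 := one_add_two_mul_integral_RIntegrand hQ.stochastic hlam x y
    -- The identity matrix lives on the diagonal, where the weight `π(y)/π(x)` is `1`.
    have h2 : (1 : Matrix E E ℝ) x y = π y / π x * (1 : Matrix E E ℝ) x y := by
      rcases eq_or_ne x y with rfl | hxy
      · simp [hx]
      · simp [hxy]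
    have h3 : (1 + R Q π lam) x y = π y / π x * ((2 + lam) * diagResolvent Q lam y x) := by
      rw [← h1, mul_add, ← h2, Matrix.add_apply, R, Matrix.of_apply]
      ring
    rw [h3, F]
    field_simp
  simp only [mulVec, dotProduct, hterm, ← Finset.mul_sum,
    sum_meetingLaplace_mul_diagResolvent hQ hX hY hXY hlam, Pi.smul_apply, smul_eq_mul]
  field_simp

lemma meetingLaplace_le (hQ : IsReversibleKernel Q π)
    (hX : IsRateOneChain Q π P X) (hY : IsRateOneChain Q π P Y)
    (hXY : IndepFun (fun ω t => X t ω) (fun ω t => Y t ω) P) (hlam : 0 < lam) (x : E) :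
    meetingLaplace P X Y lam x ≤ (2 + lam) / lam * π x ^ 2 := by
  have hx := hQ.pos x
  have h1 := congrFun (one_add_R_mulVec_F hQ hX hY hXY hlam) x
  rw [Matrix.add_mulVec, Matrix.one_mulVec, Pi.add_apply, Pi.smul_apply, smul_eq_mul] at h1
  have h2 : 0 ≤ (R Q π lam *ᵥ F π P X Y lam) x := Finset.sum_nonneg fun y _ =>
    mul_nonneg (R_nonneg hQ lam x y)
      (mul_nonneg (inv_nonneg.2 (hQ.pos y).le) (meetingLaplace_nonneg P X Y lam y))
  have h3 : (π x)⁻¹ * meetingLaplace P X Y lam x ≤ (2 + lam) / lam * π x := by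
    rw [← h1]
    exact le_add_of_nonneg_right h2
  rw [inv_mul_le_iff₀ hx] at h3
  linarith

end StrongMarkov

end MeetingTimes

theorem proposition4p1 {E : Type*} [Fintype E] [DecidableEq E]
    [MeasurableSpace E] [DiscreteMeasurableSpace E]
    (Q : Matrix E E ℝ) (π : E → ℝ) (hQ : MeetingTimes.IsReversibleKernel Q π)
    {Ω : Type*} [MeasurableSpace Ω] (P : Measure Ω) [IsProbabilityMeasure P]
    (X Y : ℝ≥0 → Ω → E)
    (hX : MeetingTimes.IsRateOneChain Q π P X) (hY : MeetingTimes.IsRateOneChain Q π P Y)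
    (hXY : IndepFun (fun ω t => X t ω) (fun ω t => Y t ω) P)
    (lam : ℝ) (hlam : 0 < lam) :
    (∀ x, Integrable (MeetingTimes.meetingWeight X Y lam x) P ∧
      MeetingTimes.meetingLaplace P X Y lam x ≤ (2 + lam) / lam * π x ^ 2) ∧
    (∀ x y, IntegrableOn (MeetingTimes.RIntegrand Q lam x y) (Set.Ioi 0) ∧
      0 ≤ MeetingTimes.R Q π lam x y) ∧
    (MeetingTimes.R Q π lam).IsSymm ∧
    (1 + MeetingTimes.R Q π lam) *ᵥ MeetingTimes.F π P X Y lam = ((2 + lam) / lam) • π := by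
  exact ⟨fun x => ⟨MeetingTimes.integrable_meetingWeight hX hY hlam x,
      MeetingTimes.meetingLaplace_le hQ hX hY hXY hlam x⟩,
    fun x y => ⟨MeetingTimes.integrableOn_RIntegrand hQ.stochastic hlam x y,
      MeetingTimes.R_nonneg hQ lam x y⟩,
    MeetingTimes.R_isSymm hQ lam, MeetingTimes.one_add_R_mulVec_F hQ hX hY hXY hlam⟩
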